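/- Let $n\ge 0$ and let $P_n=\mathbb{Q}[x_1,\dots,x_n]\otimes\bigwedge[\omega_1,\dots,\omega_n]$, where $\bigwedge[\omega_1,\dots,\omega_n]$ is the exterior algebra on the generators $\omega_i$ over $\mathbb{Q}$. For $1\le i\le n-1$ let $s_i$ be the algebra automorphism of $P_n$ that exchanges $x_i$ and $x_{i+1}$, fixes every other $x_j$, and satisfies $s_i(\omega_j)=\omega_j+\delta_{ij}(x_i^2-x_{i+1}^2)\,\omega_{i+1}$ for all $j$. Let $s_n$ be the algebra automorphism with $s_n(x_n)=-x_n$ that fixes $x_j$ for $j<n$ and all $\omega_j$. The Demazure operators are $$\partial_i(f)=\frac{f-s_i(f)}{x_i-s_i(x_i)}\qquad(1\le i\le n),$$ and $\partial_{w_0}=\partial_{i_1}\partial_{i_2}\cdots\partial_{i_r}$, where $s_{i_1}\cdots s_{i_r}$ is the reduced expression $$(s_1s_2\cdots s_n\cdots s_2s_1)(s_2\cdots s_n\cdots s_2)\cdots(s_{n-1}s_ns_{n-1})\,s_n$$ of the longest element $w_0$ of the Weyl group of type $B_n$. For a strict partition $\beta$ with $k$ parts, all in $\{1,\dots,n\}$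 and written in increasing order $\beta_1<\cdots<\beta_k$ (with $k=0$ allowed), put $\omega_\beta=\omega_{\beta_1}\cdots\omega_{\beta_k}$ and define the extended Schur polynomial $$\mathcal{S}_{0,\beta}=\partial_{w_0}\bigl(x_1^{2n-1}x_2^{2n-3}\cdots x_n^{1}\,\omega_\beta\bigr)\in P_n .$$ Let $\beta$ and $\beta'$ be strict partitions with parts in $\{1,\dots,n\}$. 1. If $\beta$ and $\beta'$ have no part in common, then $$\mathcal{S}_{0,\beta}\,\mathcal{S}_{0,\beta'}=(-1)^{\epsilon_{\beta,\beta'}}\,\mathcal{S}_{0,\beta\beta'},$$ where $\beta\beta'$ is the strict partition whose parts are those of $\beta$ together with those of $\beta'$, and $\epsilon_{\beta,\beta'}$ is the length (number of inversions) of the permutation that sorts the concatenated sequence $(\beta_1,\beta_2,\dots,\beta'_1,\beta'_2,\dots)$ into $\beta\beta'$. 2. If $\beta$ and $\beta'$ have a part in common, then $\mathcal{S}_{0,\beta}\,\mathcal{S}_{0,\beta'}=0$. -/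

import Mathlib

open scoped TensorProduct

noncomputable section

namespace ExtSchur

/-- The extended polynomial ring `ℚ[x₁,…,xₙ] ⊗ ⋀[ω₁,…,ωₙ]`. The index set `{1,…,n}` is `Fin n`:
the index `i` of the mathematical text is the element of `Fin n` with value `i - 1`. -/
def PExt (n : ℕ) : Type :=
  MvPolynomial (Fin n) ℚ ⊗[ℚ] ExteriorAlgebra ℚ (Fin n → ℚ)

instance {n : ℕ} : Ring (PExt n) :=
  inferInstanceAs (Ring (MvPolynomial (Fin n) ℚ ⊗[ℚ] ExteriorAlgebra ℚ (Fin n → ℚ)))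

instance {n : ℕ} : Algebra ℚ (PExt n) :=
  inferInstanceAs (Algebra ℚ (MvPolynomial (Fin n) ℚ ⊗[ℚ] ExteriorAlgebra ℚ (Fin n → ℚ)))

/-- The inclusion `p ↦ p ⊗ 1` of the polynomials into the extended polynomials. -/
def poly {n : ℕ} : MvPolynomial (Fin n) ℚ →ₐ[ℚ] PExt n :=
  (Algebra.TensorProduct.includeLeft : MvPolynomial (Fin n) ℚ →ₐ[ℚ]
    MvPolynomial (Fin n) ℚ ⊗[ℚ] ExteriorAlgebra ℚ (Fin n → ℚ))

/-- The inclusion `w ↦ 1 ⊗ w` of the exterior algebra into the extended polynomials. -/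
def ext {n : ℕ} : ExteriorAlgebra ℚ (Fin n → ℚ) →ₐ[ℚ] PExt n :=
  (Algebra.TensorProduct.includeRight : ExteriorAlgebra ℚ (Fin n → ℚ) →ₐ[ℚ]
    MvPolynomial (Fin n) ℚ ⊗[ℚ] ExteriorAlgebra ℚ (Fin n → ℚ))

theorem poly_mul_ext {n : ℕ} (p : MvPolynomial (Fin n) ℚ)
    (w : ExteriorAlgebra ℚ (Fin n → ℚ)) :
    poly p * ext w = (p ⊗ₜ w : MvPolynomial (Fin n) ℚ ⊗[ℚ] ExteriorAlgebra ℚ (Fin n → ℚ)) := by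
  refine (Algebra.TensorProduct.tmul_mul_tmul p 1 1 w).trans ?_
  rw [mul_one, one_mul]

theorem ext_mul_poly {n : ℕ} (p : MvPolynomial (Fin n) ℚ)
    (w : ExteriorAlgebra ℚ (Fin n → ℚ)) : ext w * poly p = poly p * ext w := by
  rw [poly_mul_ext]
  refine (Algebra.TensorProduct.tmul_mul_tmul 1 p w 1).trans ?_
  rw [mul_one, one_mul]

theorem PExt.induction {n : ℕ} {C : PExt n → Prop}
    (mul : ∀ p w, C (poly p * ext w)) (add : ∀ f g, C f → C g → C (f + g)) (f : PExt n) :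
    C f := by
  refine TensorProduct.induction_on (motive := C) f ?_ (fun p w => ?_) (fun f g => add f g)
  · have h := mul 0 0
    rwa [map_zero, zero_mul] at h
  · rw [← poly_mul_ext]
    exact mul p w

/-- The even generator `x_i`. -/
def x {n : ℕ} (i : Fin n) : PExt n := poly (MvPolynomial.X i)

/-- The odd generator `ω_i`. -/
def om {n : ℕ} (i : Fin n) : PExt n := ext (ExteriorAlgebra.ι ℚ (Pi.single i 1))

/-- The image of `x_j` under the simple reflection `s_i`, as a polynomial: for `i < n` the variables
`x_i` and `x_{i+1}` are exchanged, and `s_n` changes the sign of `x_n`. -/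
def sX {n : ℕ} (i j : Fin n) : MvPolynomial (Fin n) ℚ :=
  if h : i.val + 1 < n then MvPolynomial.X (Equiv.swap i ⟨i.val + 1, h⟩ j)
  else if j = i then -MvPolynomial.X j else MvPolynomial.X j

/-- The image of `ω_j` under the simple reflection `s_i`:
`ω_j + δ_{ij} (x_i² - x_{i+1}²) ω_{i+1}` for `i < n`, and `ω_j` for `i = n`. -/
def sOm {n : ℕ} (i j : Fin n) : PExt n :=
  if h : i.val + 1 < n then
    om j + if j = i then (x i ^ 2 - x ⟨i.val + 1, h⟩ ^ 2) * om ⟨i.val + 1, h⟩ else 0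
  else om j

theorem poly_mul_comm {n : ℕ} (p : MvPolynomial (Fin n) ℚ) (f : PExt n) :
    poly p * f = f * poly p := by
  induction f using PExt.induction with
  | mul q w => rw [mul_assoc, ext_mul_poly, ← mul_assoc, ← mul_assoc, ← map_mul, ← map_mul, mul_comm]
  | add a b ha hb => rw [mul_add, add_mul, ha, hb]

theorem om_mul_swap {n : ℕ} (i j : Fin n) : om i * om j = -(om j * om i) := by
  have h := ExteriorAlgebra.ι_add_mul_swap (R := ℚ) (Pi.single i 1 : Fin n → ℚ) (Pi.single j 1)
  rw [om, om, ← map_mul ext, ← map_mul ext, ← map_neg, eq_neg_of_add_eq_zero_left h]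

theorem poly_om_swap {n : ℕ} (p q : MvPolynomial (Fin n) ℚ) (i j : Fin n) :
    (poly p * om i) * (poly q * om j) = -((poly q * om j) * (poly p * om i)) := by
  have h1 : (poly p * om i) * (poly q * om j) = poly p * poly q * (om i * om j) := by
    rw [mul_assoc, ← mul_assoc (om i), ← poly_mul_comm q (om i)]; simp only [mul_assoc]
  have h2 : (poly q * om j) * (poly p * om i) = poly p * poly q * (om j * om i) := by
    rw [mul_assoc, ← mul_assoc (om j), ← poly_mul_comm p (om j), poly_mul_comm p (poly q)]
    simp only [mul_assoc]
  rw [h1, h2, om_mul_swap i j, mul_neg]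

theorem exists_sOm_eq {n : ℕ} (i j : Fin n) :
    ∃ (q : MvPolynomial (Fin n) ℚ) (k : Fin n), sOm i j = poly 1 * om j + poly q * om k := by
  unfold sOm
  split_ifs with h h'
  · refine ⟨MvPolynomial.X i ^ 2 - MvPolynomial.X ⟨i.val + 1, h⟩ ^ 2, ⟨i.val + 1, h⟩, ?_⟩
    simp [x]
  · exact ⟨0, j, by simp⟩
  · exact ⟨0, j, by simp⟩

theorem sOm_swap {n : ℕ} (i j k : Fin n) : sOm i j * sOm i k = -(sOm i k * sOm i j) := by
  obtain ⟨q, a, h1⟩ := exists_sOm_eq i j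
  obtain ⟨r, b, h2⟩ := exists_sOm_eq i k
  rw [h1, h2]
  simp only [mul_add, add_mul]
  rw [poly_om_swap 1 1 j k, poly_om_swap q 1 a k, poly_om_swap 1 r j b, poly_om_swap q r a b]
  abel

/-- The linear map `⟨ω₁,…,ωₙ⟩ → PExt n` given by `s_i` on the odd generators. -/
def sLin {n : ℕ} (i : Fin n) : (Fin n → ℚ) →ₗ[ℚ] PExt n :=
  Fintype.linearCombination ℚ (sOm i)

theorem sLin_sq {n : ℕ} (i : Fin n) (m : Fin n → ℚ) : sLin i m * sLin i m = 0 := by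
  have key : sLin i m * sLin i m = -(sLin i m * sLin i m) := by
    conv_lhs => simp only [sLin, Fintype.linearCombination_apply, Finset.sum_mul_sum]
    conv_rhs => simp only [sLin, Fintype.linearCombination_apply, Finset.sum_mul_sum]
    rw [← Finset.sum_neg_distrib, Finset.sum_comm]
    refine Finset.sum_congr rfl fun a _ => ?_
    rw [← Finset.sum_neg_distrib]
    refine Finset.sum_congr rfl fun b _ => ?_
    rw [smul_mul_smul_comm, smul_mul_smul_comm, sOm_swap i b a, smul_neg, mul_comm]
  have h2 : (2 : ℚ) • (sLin i m * sLin i m) = 0 := by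
    rw [two_smul]; nth_rewrite 1 [key]; simp
  exact (smul_eq_zero.mp h2).resolve_left two_ne_zero

/-- The simple reflection `s_i`, acting as an algebra endomorphism of the extended polynomials:
it is determined by `s_i(x_j)` and `s_i(ω_j)`. -/
def s {n : ℕ} (i : Fin n) : PExt n →ₐ[ℚ] PExt n :=
  (Algebra.TensorProduct.lift
    (poly.comp (MvPolynomial.aeval (sX i)))
    (ExteriorAlgebra.lift ℚ ⟨sLin i, sLin_sq i⟩)
    (fun p _ => poly_mul_comm (MvPolynomial.aeval (sX i) p) _) :
    MvPolynomial (Fin n) ℚ ⊗[ℚ] ExteriorAlgebra ℚ (Fin n → ℚ) →ₐ[ℚ] PExt n)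

theorem s_poly {n : ℕ} (i : Fin n) (p : MvPolynomial (Fin n) ℚ) :
    s i (poly p) = poly (MvPolynomial.aeval (sX i) p) :=
  (Algebra.TensorProduct.lift_tmul _ _ _ p 1).trans (by simp)

theorem s_ext {n : ℕ} (i : Fin n) (w : ExteriorAlgebra ℚ (Fin n → ℚ)) :
    s i (ext w) = ExteriorAlgebra.lift ℚ ⟨sLin i, sLin_sq i⟩ w :=
  (Algebra.TensorProduct.lift_tmul _ _ _ 1 w).trans (by simp)

theorem s_x {n : ℕ} (i j : Fin n) : s i (x j) = poly (sX i j) := by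
  simp [x, s_poly]

theorem s_om {n : ℕ} (i j : Fin n) : s i (om j) = sOm i j := by
  rw [om, s_ext, ExteriorAlgebra.lift_ι_apply]
  simp [sLin, Fintype.linearCombination_apply_single]

/-- The polynomial `x_i - s_i(x_i)`, that is `x_i - x_{i+1}` for `i < n` and `2 x_n` for `i = n`. -/
def root {n : ℕ} (i : Fin n) : MvPolynomial (Fin n) ℚ := MvPolynomial.X i - sX i i

theorem root_ne_zero {n : ℕ} (i : Fin n) : root i ≠ 0 := by
  unfold root sX
  by_cases h : i.val + 1 < n
  · rw [dif_pos h, sub_ne_zero, Equiv.swap_apply_left, Ne, MvPolynomial.X_inj]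
    intro e
    have := congrArg Fin.val e
    simp at this
  · rw [dif_neg h, if_pos rfl, sub_neg_eq_add, ← two_mul]
    exact mul_ne_zero two_ne_zero (MvPolynomial.X_ne_zero i)

theorem exists_poly_quotient {n : ℕ} (i j : Fin n) :
    ∃ q : MvPolynomial (Fin n) ℚ, root i * q = MvPolynomial.X j - sX i j := by
  unfold root
  by_cases h1 : j = i
  · exact ⟨1, by rw [h1, mul_one]⟩
  · unfold sX
    by_cases h : i.val + 1 < n
    · simp only [dif_pos h, Equiv.swap_apply_left]
      by_cases h2 : j = ⟨i.val + 1, h⟩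
      · exact ⟨-1, by rw [h2, Equiv.swap_apply_right]; ring⟩
      · exact ⟨0, by rw [Equiv.swap_apply_of_ne_of_ne h1 h2]; ring⟩
    · exact ⟨0, by rw [dif_neg h, dif_neg h, if_neg h1]; ring⟩

theorem exists_sOm_quotient {n : ℕ} (i j : Fin n) :
    ∃ g : PExt n, poly (root i) * g = om j - sOm i j := by
  unfold sOm
  by_cases h : i.val + 1 < n
  · rw [dif_pos h]
    by_cases h1 : j = i
    · rw [if_pos h1]
      refine ⟨poly (-(MvPolynomial.X i + MvPolynomial.X ⟨i.val + 1, h⟩)) * om ⟨i.val + 1, h⟩, ?_⟩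
      have e : poly (root i) * poly (-(MvPolynomial.X i + MvPolynomial.X ⟨i.val + 1, h⟩)) =
          -(x i ^ 2 - x ⟨i.val + 1, h⟩ ^ 2) := by
        have e' : root i * (-(MvPolynomial.X i + MvPolynomial.X ⟨i.val + 1, h⟩)) =
            -(MvPolynomial.X i ^ 2 - MvPolynomial.X ⟨i.val + 1, h⟩ ^ 2) := by
          unfold root sX
          rw [dif_pos h, Equiv.swap_apply_left]; ring
        have e2 := congrArg (poly (n := n)) e'
        simpa [x] using e2
      rw [← mul_assoc, e, neg_mul]
      abel
    · exact ⟨0, by rw [if_neg h1]; simp⟩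
  · exact ⟨0, by rw [dif_neg h]; simp⟩

theorem root_dvd_mul {n : ℕ} (i : Fin n) (f g : PExt n)
    (hf : ∃ a, poly (root i) * a = f - s i f) (hg : ∃ b, poly (root i) * b = g - s i g) :
    ∃ c, poly (root i) * c = f * g - s i (f * g) := by
  obtain ⟨a, ha⟩ := hf
  obtain ⟨b, hb⟩ := hg
  refine ⟨a * g + s i f * b, ?_⟩
  rw [mul_add, ← mul_assoc, ha, ← mul_assoc, poly_mul_comm (root i) (s i f), mul_assoc, hb,
    map_mul, sub_mul, mul_sub]
  abel

theorem root_dvd_add {n : ℕ} (i : Fin n) (f g : PExt n)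
    (hf : ∃ a, poly (root i) * a = f - s i f) (hg : ∃ b, poly (root i) * b = g - s i g) :
    ∃ c, poly (root i) * c = (f + g) - s i (f + g) := by
  obtain ⟨a, ha⟩ := hf
  obtain ⟨b, hb⟩ := hg
  refine ⟨a + b, ?_⟩
  rw [mul_add, ha, hb, map_add]
  abel

theorem root_dvd_algebraMap {n : ℕ} (i : Fin n) (c : ℚ) :
    ∃ a, poly (root i) * a = algebraMap ℚ (PExt n) c - s i (algebraMap ℚ (PExt n) c) :=
  ⟨0, by rw [AlgHom.commutes]; simp⟩

theorem root_dvd {n : ℕ} (i : Fin n) (f : PExt n) : ∃ g, poly (root i) * g = f - s i f := by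
  have hp : ∀ p : MvPolynomial (Fin n) ℚ,
      ∃ g, poly (root i) * g = poly p - s i (poly p) := by
    intro p
    induction p using MvPolynomial.induction_on with
    | C c =>
      have e : (poly (MvPolynomial.C c) : PExt n) = algebraMap ℚ (PExt n) c := poly.commutes c
      rw [e]
      exact root_dvd_algebraMap i c
    | add p q hp hq =>
      rw [map_add]
      exact root_dvd_add i _ _ hp hq
    | mul_X p j hp =>
      rw [map_mul]
      refine root_dvd_mul i _ _ hp ?_
      obtain ⟨q, hq⟩ := exists_poly_quotient i j
      refine ⟨poly q, ?_⟩
      change _ = x j - s i (x j)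
      rw [s_x]
      have e2 := congrArg (poly (n := n)) hq
      simpa [x] using e2
  have hl : ∀ m : Fin n → ℚ, ∃ g, poly (root i) * g =
      ext (ExteriorAlgebra.ι ℚ m) - s i (ext (ExteriorAlgebra.ι ℚ m)) := by
    intro m
    have e : ext (ExteriorAlgebra.ι ℚ m) = ∑ j, algebraMap ℚ (PExt n) (m j) * om j := by
      conv_lhs => rw [pi_eq_sum_univ' m]
      simp only [map_sum, map_smul, ← Algebra.smul_def, om]
    rw [e]
    refine Finset.sum_induction _
      (fun f : PExt n => ∃ g, poly (root i) * g = f - s i f)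
      (fun a b ha hb => root_dvd_add i a b ha hb) ⟨0, by simp⟩ fun j _ => ?_
    refine root_dvd_mul i _ _ (root_dvd_algebraMap i _) ?_
    rw [s_om]
    exact exists_sOm_quotient i j
  have hw : ∀ w : ExteriorAlgebra ℚ (Fin n → ℚ), ∃ g, poly (root i) * g =
      ext w - s i (ext w) := by
    intro w
    induction w using ExteriorAlgebra.induction with
    | algebraMap c => rw [AlgHom.commutes]; exact root_dvd_algebraMap i c
    | ι m => exact hl m
    | mul a b ha hb => rw [map_mul]; exact root_dvd_mul i _ _ ha hb
    | add a b ha hb => rw [map_add]; exact root_dvd_add i _ _ ha hb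
  induction f using PExt.induction with
  | mul p w => exact root_dvd_mul i _ _ (hp p) (hw w)
  | add a b ha hb => exact root_dvd_add i _ _ ha hb

theorem poly_mul_cancel {n : ℕ} {p : MvPolynomial (Fin n) ℚ} (hp : p ≠ 0) {a b : PExt n}
    (h : poly p * a = poly p * b) : a = b := by
  have e : ∀ f : MvPolynomial (Fin n) ℚ ⊗[ℚ] ExteriorAlgebra ℚ (Fin n → ℚ),
      (p ⊗ₜ 1) * f = p • f := by
    intro f
    induction f using TensorProduct.induction_on with
    | zero => simp
    | tmul q w => simp [TensorProduct.smul_tmul']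
    | add a b ha hb => rw [mul_add, smul_add, ha, hb]
  have h' := (e a).symm.trans (Eq.trans h (e b))
  exact smul_right_injective (MvPolynomial (Fin n) ℚ ⊗[ℚ] ExteriorAlgebra ℚ (Fin n → ℚ)) hp h'

/-- `f - s_i(f)` is divisible by `x_i - s_i(x_i)`, and the quotient is unique. -/
theorem existsUnique_quotient {n : ℕ} (i : Fin n) (f : PExt n) :
    ∃! g, poly (root i) * g = f - s i f := by
  obtain ⟨g, hg⟩ := root_dvd i f
  exact ⟨g, hg, fun g' hg' => poly_mul_cancel (root_ne_zero i) (hg'.trans hg.symm)⟩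

/-- The Demazure operator `∂_i = (id - s_i) / (x_i - s_i(x_i))`. -/
def demazure {n : ℕ} (i : Fin n) (f : PExt n) : PExt n :=
  (existsUnique_quotient i f).choose

theorem demazure_spec {n : ℕ} (i : Fin n) (f : PExt n) :
    poly (root i) * demazure i f = f - s i f :=
  (existsUnique_quotient i f).choose_spec.1

/-- The list `k, k+1, …, n`. -/
def ascending {n : ℕ} (k : Fin n) : List (Fin n) :=
  (List.finRange n).filter (fun i => k ≤ i)

/-- The word `(1 2 ⋯ n ⋯ 2 1)(2 3 ⋯ n ⋯ 3 2) ⋯ (n-1 n n-1)(n)`, which is a reduced word of the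
longest element `w₀` of the Weyl group of type `Bₙ`. -/
def longestWord (n : ℕ) : List (Fin n) :=
  (List.finRange n).flatMap (fun k => ascending k ++ (ascending k).reverse.tail)

/-- `∂_{i₁} ∂_{i₂} ⋯ ∂_{i_r}` for a word `i₁ i₂ ⋯ i_r`. -/
def demazureWord {n : ℕ} (w : List (Fin n)) (f : PExt n) : PExt n :=
  w.foldr demazure f

/-- The monomial `x^{δ+α} = x₁^{2n-1+α₁} x₂^{2n-3+α₂} ⋯ xₙ^{1+αₙ}`. -/
def monomialDelta {n : ℕ} (α : Fin n → ℕ) : PExt n :=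
  poly (∏ i : Fin n, MvPolynomial.X i ^ (2 * (n - 1 - i.val) + 1 + α i))

/-- Strict partitions with `k` parts, all of them in `{1,…,n}`, written in increasing order
`β₁ < β₂ < ⋯ < β_k`. -/
abbrev StrictPartition (n k : ℕ) : Type := Fin k ↪o Fin n

/-- `ω_β = ω_{β₁} ω_{β₂} ⋯ ω_{β_k}`. -/
def omProd {n k : ℕ} (β : StrictPartition n k) : PExt n :=
  (List.ofFn fun j => om (β j)).prod

/-- The extended Schur polynomial `S_{α,β} = ∂_{w₀}(x^{δ+α} ω_β)`. -/
def schur {n k : ℕ} (α : Fin n → ℕ) (β : StrictPartition n k) : PExt n :=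
  demazureWord (longestWord n) (monomialDelta α * omProd β)

/-- The concatenation `β ⊔ β'`, the sequence `β₁, …, β_k, β'₁, …, β'_l`. -/
def concat {n k l : ℕ} (β : StrictPartition n k) (β' : StrictPartition n l) :
    Fin (k + l) → Fin n :=
  Fin.append β β'

/-- The permutation of positions that rearranges `β ⊔ β'` into increasing order. -/
def sortPerm {n k l : ℕ} (β : StrictPartition n k) (β' : StrictPartition n l) :
    Equiv.Perm (Fin (k + l)) :=
  Tuple.sort (concat β β')

/-- `β` and `β'` have no part in common. -/
def NoCommonPart {n k l : ℕ} (β : StrictPartition n k) (β' : StrictPartition n l) : Prop :=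
  ∀ a b, β a ≠ β' b

theorem strictMono_sort {n k l : ℕ} (β : StrictPartition n k) (β' : StrictPartition n l)
    (h : NoCommonPart β β') : StrictMono (concat β β' ∘ sortPerm β β') := by
  refine (Tuple.monotone_sort (concat β β')).strictMono_of_injective ?_
  exact ((Fin.append_injective_iff).mpr ⟨β.injective, β'.injective, h⟩).comp
    (sortPerm β β').injective

/-- The strict partition `ββ'` whose parts are those of `β` together with those of `β'`. -/
def merge {n k l : ℕ} (β : StrictPartition n k) (β' : StrictPartition n l)
    (h : NoCommonPart β β') : StrictPartition n (k + l) :=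
  OrderEmbedding.ofStrictMono (concat β β' ∘ sortPerm β β') (strictMono_sort β β' h)

/-- The length of a permutation: its number of inversions. -/
def permLength {m : ℕ} (σ : Equiv.Perm (Fin m)) : ℕ :=
  (Finset.univ.filter fun p : Fin m × Fin m => p.1 < p.2 ∧ σ p.2 < σ p.1).card

/-- `ε_{β,β'}`, the length of the permutation that takes `β ⊔ β'` to `ββ'`. -/
def eps {n k l : ℕ} (β : StrictPartition n k) (β' : StrictPartition n l) : ℕ :=
  permLength (sortPerm β β')

end ExtSchur

end

noncomputable section

namespace ExtSchur

/-! The point is that there are odd elements θ_k (`theta`), fixed by every s_i, with ω_k = ∑_{j≥k}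
e_{j-k}(x_{k+1}²,…,x_n²) θ_j. Their invariance (`s_theta`) reflects how elementary symmetric
polynomials change when x_{k+1} is replaced by x_k. The Schur polynomial S_{0,β} turns out to be the
product of the θ's indexed by β (`schur_eq_prod`). Since the θ's anticommute and square to zero,
both claims become statements about the exterior algebra.

For the product formula, the word of w₀ is cut into blocks k⋯n⋯k. The operator of block k is linear
over elements fixed by all s_i with i ≥ k, so it sees only x_k^{2(n-k)+1} and, if present, ω_k. It
must send x_k^{2(n-k)+1} e_d(x_{k+1}²,…,x_n²) to 1 for d = 0 and to 0 otherwise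
(`demazureWord_block_pow_mul_coeff`). Put V = ∏_{p≥k} (1 - x_p²T²)⁻¹. Then ∑ x_k^m T^m = V (1 + x_k
T) ∏_{p>k} (1 - x_p²T²), and by `demazure_coeff` each letter of the block strips one linear factor
and lowers the degree by one, until V alone remains. -/

/-- The action of `s_i` on polynomials. -/
def sPoly {n : ℕ} (i : Fin n) : MvPolynomial (Fin n) ℚ →+* MvPolynomial (Fin n) ℚ :=
  (MvPolynomial.aeval (sX i) : MvPolynomial (Fin n) ℚ →ₐ[ℚ] MvPolynomial (Fin n) ℚ)

theorem s_poly_eq_sPoly {n : ℕ} (i : Fin n) (p : MvPolynomial (Fin n) ℚ) :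
    s i (poly p) = poly (sPoly i p) := s_poly i p

theorem sPoly_X {n : ℕ} (i j : Fin n) : sPoly i (MvPolynomial.X j) = sX i j := by
  simp [sPoly]

theorem demazure_eq {n : ℕ} {i : Fin n} {f g : PExt n} (h : poly (root i) * g = f - s i f) :
    demazure i f = g :=
  poly_mul_cancel (root_ne_zero i) ((demazure_spec i f).trans h.symm)

theorem demazure_poly {n : ℕ} {i : Fin n} {p q : MvPolynomial (Fin n) ℚ}
    (h : root i * q = p - sPoly i p) : demazure i (poly p) = poly q :=
  demazure_eq (by rw [s_poly_eq_sPoly, ← map_mul, h, map_sub])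

theorem demazure_add {n : ℕ} (i : Fin n) (f g : PExt n) :
    demazure i (f + g) = demazure i f + demazure i g :=
  demazure_eq (by rw [mul_add, demazure_spec, demazure_spec, map_add]; abel)

/-- The ring is not commutative, so invariant factors are needed on both sides. The only commutation
involved is that polynomials, in particular the denominator, are central. -/
theorem demazure_mul_right {n : ℕ} {i : Fin n} {a : PExt n} (ha : s i a = a) (f : PExt n) :
    demazure i (f * a) = demazure i f * a :=
  demazure_eq (by rw [← mul_assoc, demazure_spec, map_mul, ha, sub_mul])

theorem demazure_mul_left {n : ℕ} {i : Fin n} {a : PExt n} (ha : s i a = a) (f : PExt n) :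
    demazure i (a * f) = a * demazure i f :=
  demazure_eq (by
    rw [← mul_assoc, poly_mul_comm, mul_assoc, demazure_spec, map_mul, ha, mul_sub])

theorem demazureWord_append {n : ℕ} (v w : List (Fin n)) (f : PExt n) :
    demazureWord (v ++ w) f = demazureWord v (demazureWord w f) := by
  simp [demazureWord]

theorem demazureWord_add {n : ℕ} (w : List (Fin n)) (f g : PExt n) :
    demazureWord w (f + g) = demazureWord w f + demazureWord w g := by
  induction w with
  | nil => rfl
  | cons i w ih =>
    change demazure i (demazureWord w (f + g)) = _
    rw [ih, demazure_add]; rfl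

theorem demazureWord_sum {n : ℕ} (w : List (Fin n)) {ι : Type*} (t : Finset ι) (f : ι → PExt n) :
    demazureWord w (∑ j ∈ t, f j) = ∑ j ∈ t, demazureWord w (f j) :=
  map_sum (AddMonoidHom.mk' (demazureWord w) (demazureWord_add w)) f t

theorem demazureWord_mul_right {n : ℕ} {w : List (Fin n)} {a : PExt n}
    (ha : ∀ i ∈ w, s i a = a) (f : PExt n) :
    demazureWord w (f * a) = demazureWord w f * a := by
  induction w with
  | nil => rfl
  | cons i w ih =>
    change demazure i (demazureWord w (f * a)) = _
    rw [ih fun j hj => ha j (List.mem_cons_of_mem _ hj), demazure_mul_right (ha i (by simp))]; rfl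

theorem demazureWord_mul_left {n : ℕ} {w : List (Fin n)} {a : PExt n}
    (ha : ∀ i ∈ w, s i a = a) (f : PExt n) :
    demazureWord w (a * f) = a * demazureWord w f := by
  induction w with
  | nil => rfl
  | cons i w ih =>
    change demazure i (demazureWord w (a * f)) = _
    rw [ih fun j hj => ha j (List.mem_cons_of_mem _ hj), demazure_mul_left (ha i (by simp))]; rfl

/-! ### Generating functions -/

/-- The action of `s_i` on the coefficients of a power series. -/
def sSeries {n : ℕ} (i : Fin n) :
    PowerSeries (MvPolynomial (Fin n) ℚ) →+* PowerSeries (MvPolynomial (Fin n) ℚ) :=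
  PowerSeries.map (sPoly i)

/-- If `V` is `s_i`-invariant and `a - s_i a = x_i - s_i x_i`, then `∂_i` maps the coefficients of
`V (1 - s_i(a) T)` to those of `V`, with the degree lowered by one. -/
theorem demazure_coeff {n : ℕ} (i : Fin n) {V : PowerSeries (MvPolynomial (Fin n) ℚ)}
    (hV : sSeries i V = V) {a b : MvPolynomial (Fin n) ℚ} (hab : sPoly i b = a)
    (h : a - b = root i) (m : ℕ) :
    demazure i (poly (PowerSeries.coeff (m + 1) (V * (1 - PowerSeries.C b * PowerSeries.X)))) =
      poly (PowerSeries.coeff m V) := by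
  apply demazure_poly
  rw [← PowerSeries.coeff_map, ← sSeries, map_mul (sSeries i), hV]
  have e : ∀ c : MvPolynomial (Fin n) ℚ, PowerSeries.coeff (m + 1)
      (V * (1 - PowerSeries.C c * PowerSeries.X)) =
      PowerSeries.coeff (m + 1) V - PowerSeries.coeff m V * c := by
    intro c
    rw [mul_sub, mul_one, ← mul_assoc, map_sub, PowerSeries.coeff_succ_mul_X,
      PowerSeries.coeff_mul_C]
  have e2 : sSeries i (1 - PowerSeries.C b * PowerSeries.X) =
      1 - PowerSeries.C a * PowerSeries.X := by
    simp [sSeries, hab]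
  rw [e2, e, e, ← h]
  ring

/-- The product of `1 + x_p T` over `k ≤ p < a` and of `1 - x_p² T²` over `max k a ≤ p < b`
(positions counted from zero). -/
def factorProd (n k a b : ℕ) : PowerSeries (MvPolynomial (Fin n) ℚ) :=
  ∏ p : Fin n, if p.val < k then 1
    else if p.val < a then 1 + PowerSeries.C (MvPolynomial.X p) * PowerSeries.X
    else if p.val < b then 1 - PowerSeries.C (MvPolynomial.X p ^ 2) * PowerSeries.X ^ 2
    else 1

theorem prod_eq_mul_of_ne {ι M : Type*} [Fintype ι] [CommMonoid M] {f g : ι → M} (j : ι)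
    {c : M} (hj : f j = g j * c) (h : ∀ p, p ≠ j → f p = g p) : ∏ p, f p = (∏ p, g p) * c := by
  classical
  rw [← Finset.mul_prod_erase _ f (Finset.mem_univ j),
    ← Finset.mul_prod_erase _ g (Finset.mem_univ j), hj,
    Finset.prod_congr rfl fun p hp => h p (Finset.ne_of_mem_erase hp)]
  exact mul_right_comm _ _ _

theorem factorProd_succ_left {n k b : ℕ} (hk : k < n) (hb : k < b) :
    factorProd n k k b = factorProd n (k + 1) (k + 1) b *
      (1 - PowerSeries.C (MvPolynomial.X ⟨k, hk⟩ ^ 2) * PowerSeries.X ^ 2) := by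
  apply prod_eq_mul_of_ne ⟨k, hk⟩
  · simp [hb]
  · intro p hp
    have hp' : p.val ≠ k := fun e => hp (Fin.ext e)
    split_ifs <;> first | omega | rfl

/-- This is 1 - x²T² = (1 + xT)(1 - xT) at position `a`. -/
theorem factorProd_even_to_odd {n k a b : ℕ} (ha : a < n) (hk : k ≤ a) (hb : a < b) :
    factorProd n k a b = factorProd n k (a + 1) b *
      (1 - PowerSeries.C (MvPolynomial.X ⟨a, ha⟩) * PowerSeries.X) := by
  apply prod_eq_mul_of_ne ⟨a, ha⟩
  · simp only [not_lt.mpr hk, if_false, lt_irrefl, hb, if_true, Nat.lt_succ_self, map_pow]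
    ring
  · intro p hp
    have hp' : p.val ≠ a := fun e => hp (Fin.ext e)
    split_ifs <;> first | omega | rfl

theorem factorProd_odd_succ {n k a : ℕ} (ha : a < n) (hk : k ≤ a) :
    factorProd n k (a + 1) 0 = factorProd n k a 0 *
      (1 - PowerSeries.C (-MvPolynomial.X ⟨a, ha⟩) * PowerSeries.X) := by
  apply prod_eq_mul_of_ne ⟨a, ha⟩
  · simp [not_lt.mpr hk]
  · intro p hp
    have hp' : p.val ≠ a := fun e => hp (Fin.ext e)
    split_ifs <;> first | omega | rfl

theorem factorProd_full {n k b : ℕ} : factorProd n k n b = factorProd n k n 0 := by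
  refine Finset.prod_congr rfl fun p _ => ?_
  have := p.2
  split_ifs <;> first | omega | rfl

theorem factorProd_empty {n k : ℕ} : factorProd n k k 0 = 1 := by
  refine Finset.prod_eq_one fun p _ => ?_
  split_ifs <;> first | omega | rfl

theorem sX_swap {n : ℕ} {i : Fin n} (hi : i.val + 1 < n) (j : Fin n) :
    sX i j = MvPolynomial.X (Equiv.swap i ⟨i.val + 1, hi⟩ j) := by
  rw [sX, dif_pos hi]

theorem sX_last {n : ℕ} {i : Fin n} (hi : ¬ i.val + 1 < n) (j : Fin n) :
    sX i j = if j = i then -MvPolynomial.X j else MvPolynomial.X j := by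
  rw [sX, dif_neg hi]

theorem swap_lt_iff {n : ℕ} {i : Fin n} (hi : i.val + 1 < n) {c : ℕ} (hc : c ≠ i.val + 1)
    (p : Fin n) : (Equiv.swap i ⟨i.val + 1, hi⟩ p).val < c ↔ p.val < c := by
  rw [Equiv.swap_apply_def]
  split_ifs with h1 h2
  · subst h1; simp only; omega
  · subst h2; simp only; omega
  · rfl

/-- The reflection exchanges two neighbouring positions, and the hypotheses say that no threshold
separates them, so both carry the same type of factor. -/
theorem sSeries_factorProd {n : ℕ} {i : Fin n} (hi : i.val + 1 < n) {k a b : ℕ}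
    (hk : k ≠ i.val + 1) (ha : a ≠ i.val + 1) (hb : b ≠ i.val + 1) :
    sSeries i (factorProd n k a b) = factorProd n k a b := by
  rw [factorProd, map_prod]
  refine Fintype.prod_equiv (Equiv.swap i ⟨i.val + 1, hi⟩) _ _ fun p => ?_
  simp only [swap_lt_iff hi hk, swap_lt_iff hi ha, swap_lt_iff hi hb, apply_ite (sSeries i)]
  simp [sSeries, sPoly_X, sX_swap hi]

/-- The last reflection is a sign change. It only moves a factor 1 + x_n T, which `h` excludes. -/
theorem sSeries_factorProd_last {n : ℕ} {i : Fin n} (hi : ¬ i.val + 1 < n) {k a b : ℕ}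
    (h : a ≤ i.val ∨ i.val < k) :
    sSeries i (factorProd n k a b) = factorProd n k a b := by
  rw [factorProd, map_prod]
  refine Finset.prod_congr rfl fun p _ => ?_
  simp only [apply_ite (sSeries i)]
  by_cases hp : p = i
  · subst hp
    have : p.val < a → p.val < k := by omega
    split_ifs <;> first | omega | simp [sSeries, sPoly_X, sX_last hi]
  · simp [sSeries, sPoly_X, sX_last hi, hp]

theorem constantCoeff_factorProd (n k a b : ℕ) :
    PowerSeries.constantCoeff (factorProd n k a b) = 1 := by
  rw [factorProd, map_prod]
  refine Finset.prod_eq_one fun p _ => ?_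
  split_ifs <;> simp

/-- With equal first thresholds no linear factor occurs, so the series is unchanged under T ↦ -T. -/
theorem coeff_factorProd_odd {n k b m : ℕ} (hm : Odd m) :
    PowerSeries.coeff m (factorProd n k k b) = 0 := by
  have h : PowerSeries.evalNegHom (factorProd n k k b) = factorProd n k k b := by
    rw [factorProd, map_prod]
    refine Finset.prod_congr rfl fun p _ => ?_
    have hC : ∀ c : MvPolynomial (Fin n) ℚ,
        PowerSeries.evalNegHom (PowerSeries.C c) = PowerSeries.C c := fun c => by
      ext d : 1
      rw [PowerSeries.evalNegHom, PowerSeries.coeff_rescale, PowerSeries.coeff_C]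
      split_ifs with hd <;> simp [hd]
    split_ifs
    · rw [map_one]
    · rw [map_sub, map_one, map_mul, hC, map_pow PowerSeries.evalNegHom, PowerSeries.evalNegHom_X, neg_sq]
    · rw [map_one]
  have h2 := congrArg (PowerSeries.coeff m) h
  rw [PowerSeries.evalNegHom, PowerSeries.coeff_rescale, hm.neg_one_pow, neg_one_mul] at h2
  exact self_eq_neg.mp h2.symm

/-! ### The invariant odd generators -/

/-- The coefficients of `ω_k` with respect to the invariant odd generators. -/
def omCoeff {n : ℕ} (k j : Fin n) : MvPolynomial (Fin n) ℚ :=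
  (-1) ^ (j.val - k.val) *
    PowerSeries.coeff (2 * (j.val - k.val)) (factorProd n (k.val + 1) (k.val + 1) n)

/-- The invariant odd generators. -/
def theta {n : ℕ} (k : Fin n) : PExt n :=
  om k - ∑ j ∈ (Finset.Ioi k).attach, poly (omCoeff k j.1) * theta j.1
termination_by n - k.val
decreasing_by
  have := j.1.2
  have hj : k < j.1 := Finset.mem_Ioi.mp j.2
  have : k.val < j.1.val := hj
  omega

theorem omCoeff_self {n : ℕ} (k : Fin n) : omCoeff k k = 1 := by
  simp [omCoeff, constantCoeff_factorProd]

theorem om_eq_add {n : ℕ} (k : Fin n) :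
    om k = theta k + ∑ j ∈ Finset.Ioi k, poly (omCoeff k j) * theta j := by
  rw [theta, Finset.sum_attach (Finset.Ioi k) fun j => poly (omCoeff k j) * theta j,
    sub_add_cancel]

theorem om_eq_sum {n : ℕ} (k : Fin n) :
    om k = ∑ j ∈ Finset.Ici k, poly (omCoeff k j) * theta j := by
  rw [om_eq_add k, ← Finset.Ioi_insert k, Finset.sum_insert (by simp), omCoeff_self, map_one,
    one_mul]

theorem s_om_of_ne {n : ℕ} {i k : Fin n} (h : i ≠ k ∨ ¬ i.val + 1 < n) : s i (om k) = om k := by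
  rw [s_om, sOm]
  split_ifs with h1 h2
  · exact absurd h2.symm (h.resolve_right (not_not_intro h1))
  · rw [add_zero]
  · rfl

/-- The coefficients are symmetric in the squares of the variables after x_k; only s_k mixes x_k
with these. -/
theorem sPoly_omCoeff {n : ℕ} {i k : Fin n} (h : i ≠ k ∨ ¬ i.val + 1 < n) (j : Fin n) :
    sPoly i (omCoeff k j) = omCoeff k j := by
  have hE : sSeries i (factorProd n (k.val + 1) (k.val + 1) n) =
      factorProd n (k.val + 1) (k.val + 1) n := by
    by_cases hi : i.val + 1 < n
    · have hk : k.val + 1 ≠ i.val + 1 := fun e =>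
        h.resolve_right (not_not_intro hi) (Fin.ext (by omega))
      exact sSeries_factorProd hi hk hk (by omega)
    · exact sSeries_factorProd_last hi (by omega)
  rw [omCoeff, map_mul, map_pow, map_neg, map_one, ← PowerSeries.coeff_map]
  exact congrArg (fun F => _ * PowerSeries.coeff _ F) hE

/-- With F the product over the positions after k + 1, s_k turns F(1 - x_{k+1}²T²) into F(1 -
x_k²T²). The difference is a multiple of T²F, and F generates the coefficients of ω_{k+1}. -/
theorem sPoly_omCoeff_self {n : ℕ} {k : Fin n} (hk : k.val + 1 < n) {j : Fin n} (hj : k < j) :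
    sPoly k (omCoeff k j) = omCoeff k j +
      (MvPolynomial.X k ^ 2 - MvPolynomial.X ⟨k.val + 1, hk⟩ ^ 2) *
        omCoeff ⟨k.val + 1, hk⟩ j := by
  have hj' : k.val < j.val := hj
  obtain ⟨d, hd⟩ : ∃ d, j.val = k.val + 1 + d := ⟨j.val - k.val - 1, by omega⟩
  have hc : ∀ (F : PowerSeries (MvPolynomial (Fin n) ℚ)) (c : MvPolynomial (Fin n) ℚ),
      PowerSeries.coeff (2 * (d + 1)) (F * (1 - PowerSeries.C c * PowerSeries.X ^ 2)) =
      PowerSeries.coeff (2 * (d + 1)) F - PowerSeries.coeff (2 * d) F * c := by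
    intro F c
    rw [mul_sub, mul_one, ← mul_assoc, map_sub, show 2 * (d + 1) = 2 * d + 2 by ring,
      PowerSeries.coeff_mul_X_pow, PowerSeries.coeff_mul_C]
  have hE := factorProd_succ_left hk hk
  have hs : sSeries k (factorProd n (k.val + 1) (k.val + 1) n) =
      factorProd n (k.val + 1 + 1) (k.val + 1 + 1) n *
        (1 - PowerSeries.C (MvPolynomial.X k ^ 2) * PowerSeries.X ^ 2) := by
    rw [hE, map_mul, sSeries_factorProd hk (by omega) (by omega) (by omega)]
    simp [sSeries, sPoly_X, sX_swap hk]
  have h1 : j.val - k.val = d + 1 := by omega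
  have h2 : j.val - (k.val + 1) = d := by omega
  simp only [omCoeff, h1, h2]
  rw [map_mul, map_pow, map_neg, map_one, ← PowerSeries.coeff_map, ← sSeries, hs, hE, hc, hc]
  ring

/-- Downward induction on k. Only i = k < n is delicate: there the correction (x_k² - x_{k+1}²)
ω_{k+1}, expanded in the later θ's, cancels the change of the coefficients. -/
theorem s_theta {n : ℕ} (i k : Fin n) : s i (theta k) = theta k := by
  obtain ⟨d, hd⟩ : ∃ d, n - k.val = d := ⟨_, rfl⟩
  induction d using Nat.strong_induction_on generalizing k with
  | _ d ih =>
    have IH : ∀ j, k < j → s i (theta j) = theta j := fun j hj => by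
      have hj' : k.val < j.val := hj
      exact ih (n - j.val) (by omega) j rfl
    have e : theta k = om k - ∑ j ∈ Finset.Ioi k, poly (omCoeff k j) * theta j := by
      rw [om_eq_add k, add_sub_cancel_right]
    have e2 : s i (theta k) = s i (om k) -
        ∑ j ∈ Finset.Ioi k, poly (sPoly i (omCoeff k j)) * theta j := by
      rw [e, map_sub, map_sum]
      congr 1
      refine Finset.sum_congr rfl fun j hj => ?_
      rw [map_mul, s_poly_eq_sPoly, IH j (Finset.mem_Ioi.mp hj)]
    rw [e2]
    by_cases h : i ≠ k ∨ ¬ i.val + 1 < n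
    · rw [s_om_of_ne h, e]
      simp only [sPoly_omCoeff h]
    · push Not at h
      obtain ⟨rfl, hi⟩ := h
      have hI : Finset.Ici (⟨i.val + 1, hi⟩ : Fin n) = Finset.Ioi i := by
        ext j
        rw [Finset.mem_Ici, Finset.mem_Ioi]
        exact Nat.succ_le_iff
      rw [s_om, sOm, dif_pos hi, if_pos rfl, om_eq_sum ⟨i.val + 1, hi⟩, hI, e, Finset.mul_sum,
        add_sub_assoc, ← Finset.sum_sub_distrib, sub_eq_add_neg (om i), ← Finset.sum_neg_distrib]
      congr 1
      refine Finset.sum_congr rfl fun j hj => ?_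
      rw [sPoly_omCoeff_self hi (Finset.mem_Ioi.mp hj), map_add, map_mul, map_sub, map_pow, map_pow]
      simp only [x]
      noncomm_ring

/-! ### One block k⋯n⋯k of the longest word -/

/-- The list of the elements of `Fin n` that are at least `k`. -/
def ascendingFrom (n k : ℕ) : List (Fin n) :=
  (List.finRange n).filter (fun i => k ≤ i.val)

theorem ascendingFrom_eq_cons {n k : ℕ} (hk : k < n) :
    ascendingFrom n k = ⟨k, hk⟩ :: ascendingFrom n (k + 1) := by
  have hs : ∀ c, (ascendingFrom n c).Pairwise (· < ·) := fun c =>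
    (List.pairwise_lt_finRange n).filter _
  refine (hs k).eq_of_mem_iff (List.pairwise_cons.mpr ⟨fun a ha => ?_, hs (k + 1)⟩) fun a => ?_
  · simpa [ascendingFrom, Fin.lt_def, Nat.succ_le_iff] using ha
  · simp only [ascendingFrom, List.mem_filter, List.mem_finRange, true_and, decide_eq_true_eq,
      List.mem_cons, Fin.ext_iff]
    omega

theorem ascendingFrom_self (n : ℕ) : ascendingFrom n n = [] := by
  simp [ascendingFrom, List.filter_eq_nil_iff]

theorem mem_ascendingFrom {n k : ℕ} {i : Fin n} : i ∈ ascendingFrom n k ↔ k ≤ i.val := by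
  simp [ascendingFrom]

/-- The word `k ⋯ n ⋯ k`. -/
def block {n : ℕ} (k : Fin n) : List (Fin n) :=
  ascending k ++ (ascending k).reverse.tail

theorem ascending_eq {n : ℕ} (k : Fin n) : ascending k = ascendingFrom n k.val := rfl

theorem le_of_mem_block {n : ℕ} {k i : Fin n} (h : i ∈ block k) : k ≤ i := by
  rw [block, List.mem_append] at h
  have hi : i ∈ ascending k := h.elim id fun h => List.mem_reverse.mp (List.mem_of_mem_tail h)
  exact mem_ascendingFrom.mp hi

/-- Operators act from the right end of the word, so the factors 1 + x_p T disappear from the last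
position downwards. -/
theorem demazureWord_ascendingFrom {n k : ℕ} {V : PowerSeries (MvPolynomial (Fin n) ℚ)}
    (hV : ∀ i : Fin n, k ≤ i.val → sSeries i V = V) (d : ℕ) {j : ℕ} (hj : j + d = n) (hk : k ≤ j)
    (m : ℕ) :
    demazureWord (ascendingFrom n j)
      (poly (PowerSeries.coeff (m + d) (V * factorProd n k n 0))) =
      poly (PowerSeries.coeff m (V * factorProd n k j 0)) := by
  induction d generalizing j m with
  | zero =>
    obtain rfl : j = n := hj
    rw [add_zero, ascendingFrom_self]; rfl
  | succ d ih =>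
    have hjn : j < n := by omega
    rw [ascendingFrom_eq_cons hjn, show m + (d + 1) = m + 1 + d by ring]
    change demazure _ (demazureWord _ _) = _
    rw [ih (by omega) (by omega), factorProd_odd_succ hjn hk, ← mul_assoc]
    -- Here 1 + x_j T is read as 1 - bT with b = -x_j, which treats the swaps and the final sign
    -- change uniformly.
    refine demazure_coeff _ (a := -sX ⟨j, hjn⟩ ⟨j, hjn⟩) ?_ ?_ ?_ m
    · rw [map_mul, hV _ hk]
      congr 1
      by_cases hi : j + 1 < n
      · exact sSeries_factorProd hi (by simp only; omega) (by simp) (by simp)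
      · exact sSeries_factorProd_last hi (Or.inl le_rfl)
    · rw [map_neg, sPoly_X]
    · rw [root]; ring

/-- The letter j acts first: it removes 1 - x_{j+1}T from 1 - x_{j+1}²T² and leaves 1 + x_{j+1}T,
until all factors are linear. -/
theorem demazureWord_reverse_tail {n k : ℕ} {V : PowerSeries (MvPolynomial (Fin n) ℚ)}
    (hV : ∀ i : Fin n, k ≤ i.val → sSeries i V = V) (d : ℕ) {j : ℕ} (hj : j + d + 1 = n)
    (hk : k ≤ j) (m : ℕ) :
    demazureWord (ascendingFrom n j).reverse.tail
      (poly (PowerSeries.coeff (m + d) (V * factorProd n k (j + 1) n))) =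
      poly (PowerSeries.coeff m (V * factorProd n k n n)) := by
  induction d generalizing j m with
  | zero =>
    have hjn : j < n := by omega
    rw [ascendingFrom_eq_cons hjn, show j + 1 = n by omega, ascendingFrom_self]; rfl
  | succ d ih =>
    have hjn : j < n := by omega
    have hjn' : j + 1 < n := by omega
    rw [ascendingFrom_eq_cons hjn, List.reverse_cons, List.tail_append_of_ne_nil
      (by rw [ascendingFrom_eq_cons hjn']; simp), demazureWord_append, ← ih (j := j + 1)
      (by omega) (by omega), factorProd_even_to_odd hjn' (by omega) hjn', ← mul_assoc, ← add_assoc]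
    congr 1
    refine demazure_coeff _ (a := MvPolynomial.X ⟨j, hjn⟩) ?_ ?_ ?_ _
    · rw [map_mul, hV _ hk]
      congr 1
      exact sSeries_factorProd hjn' (by simp only; omega) (by simp) (by simp only; omega)
    · rw [sPoly_X, sX_swap hjn', Equiv.swap_apply_right]
    · rw [root, sX_swap hjn', Equiv.swap_apply_left]

theorem mk_pow_mul {R : Type*} [CommRing R] (a : R) :
    PowerSeries.mk (fun m => a ^ m) * (1 - PowerSeries.C a * PowerSeries.X) = 1 := by
  ext m
  rw [mul_sub, mul_one, ← mul_assoc, map_sub]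
  cases m with
  | zero => simp
  | succ m =>
    rw [PowerSeries.coeff_succ_mul_X, PowerSeries.coeff_mul_C, PowerSeries.coeff_mk,
      PowerSeries.coeff_mk, ← pow_succ, sub_self, PowerSeries.coeff_one, if_neg (by omega)]

/-- The inverse of an invariant series is invariant, by uniqueness of inverses. -/
theorem exists_inverse_factorProd {n : ℕ} (k : ℕ) :
    ∃ V : PowerSeries (MvPolynomial (Fin n) ℚ), V * factorProd n k k n = 1 ∧
      ∀ i : Fin n, k ≤ i.val → sSeries i V = V := by
  have hu : IsUnit (factorProd n k k n) := by
    rw [PowerSeries.isUnit_iff_constantCoeff, constantCoeff_factorProd]; exact isUnit_one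
  obtain ⟨V, hV⟩ := hu.exists_left_inv
  refine ⟨V, hV, fun i hi => ?_⟩
  have hE : sSeries i (factorProd n k k n) = factorProd n k k n := by
    by_cases h : i.val + 1 < n
    · exact sSeries_factorProd h (by omega) (by omega) (by omega)
    · exact sSeries_factorProd_last h (by omega)
  have h2 := congrArg (sSeries i) hV
  rw [map_mul, hE, map_one] at h2
  exact hu.mul_right_cancel (h2.trans hV.symm)

theorem sPoly_coeff_factorProd {n : ℕ} {i k : Fin n} (hi : k ≤ i) (m : ℕ) :
    sPoly i (PowerSeries.coeff m (factorProd n k k n)) =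
      PowerSeries.coeff m (factorProd n k k n) := by
  have hi' : k.val ≤ i.val := hi
  rw [← PowerSeries.coeff_map]
  change PowerSeries.coeff m (sSeries i _) = _
  congr 1
  by_cases h : i.val + 1 < n
  · exact sSeries_factorProd h (by omega) (by omega) (by omega)
  · exact sSeries_factorProd_last h (by omega)

theorem demazureWord_block_pow {n : ℕ} (k : Fin n) {V : PowerSeries (MvPolynomial (Fin n) ℚ)}
    (hV : V * factorProd n k k n = 1)
    (hs : ∀ i : Fin n, k.val ≤ i.val → sSeries i V = V) (m : ℕ) :
    demazureWord (block k) (poly (MvPolynomial.X k ^ (2 * (n - 1 - k.val) + 1 + m))) =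
      poly (PowerSeries.coeff m V) := by
  have hk := k.2
  have h0 : V * factorProd n k (k + 1) n = PowerSeries.mk fun m => MvPolynomial.X k ^ m := by
    have h1 : V * factorProd n k (k + 1) n *
        (1 - PowerSeries.C (MvPolynomial.X k) * PowerSeries.X) = 1 := by
      rwa [factorProd_even_to_odd hk le_rfl hk, ← mul_assoc, Fin.eta] at hV
    have h2 := mk_pow_mul (MvPolynomial.X k : MvPolynomial (Fin n) ℚ)
    calc _ = V * factorProd n k (k + 1) n * ((PowerSeries.mk fun m => MvPolynomial.X k ^ m) *
          (1 - PowerSeries.C (MvPolynomial.X k) * PowerSeries.X)) := by rw [h2, mul_one]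
      _ = (V * factorProd n k (k + 1) n * (1 - PowerSeries.C (MvPolynomial.X k) * PowerSeries.X)) *
          (PowerSeries.mk fun m => MvPolynomial.X k ^ m) := by ring
      _ = _ := by rw [h1, one_mul]
  -- The first letters to act lower the degree by n - 1 - k, the ascending part by n - k.
  have h1 : (MvPolynomial.X k ^ (2 * (n - 1 - k.val) + 1 + m) : MvPolynomial (Fin n) ℚ) =
      PowerSeries.coeff (m + (n - k.val) + (n - 1 - k.val)) (V * factorProd n k (k + 1) n) := by
    rw [h0, PowerSeries.coeff_mk]
    congr 1
    omega
  rw [block, demazureWord_append, h1, ascending_eq,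
    demazureWord_reverse_tail hs (n - 1 - k.val) (by omega) le_rfl, factorProd_full,
    demazureWord_ascendingFrom hs (n - k.val) (by omega) le_rfl, factorProd_empty, mul_one]

/-- The series E of the positions after k is even, so multiplying by 1 + x_k T keeps its even
coefficients. The product equals E_k ∑ x_k^m T^m with E_k invariant under the block, and the block
turns the geometric series into V = E_k⁻¹. -/
theorem demazureWord_block_pow_mul_coeff {n : ℕ} (k : Fin n) (d : ℕ) :
    demazureWord (block k) (poly (MvPolynomial.X k ^ (2 * (n - 1 - k.val) + 1) *
      PowerSeries.coeff (2 * d) (factorProd n (k + 1) (k + 1) n))) =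
      if d = 0 then 1 else 0 := by
  obtain ⟨V, hV, hs⟩ := exists_inverse_factorProd (n := n) k.val
  have hE : (1 + PowerSeries.C (MvPolynomial.X k) * PowerSeries.X) *
      factorProd n (k + 1) (k + 1) n =
      factorProd n k k n * PowerSeries.mk fun m => MvPolynomial.X k ^ m := by
    rw [factorProd_succ_left k.2 k.2]
    calc _ = (1 + PowerSeries.C (MvPolynomial.X k) * PowerSeries.X) *
          factorProd n (k + 1) (k + 1) n * ((PowerSeries.mk fun m => MvPolynomial.X k ^ m) *
          (1 - PowerSeries.C (MvPolynomial.X k) * PowerSeries.X)) := by rw [mk_pow_mul, mul_one]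
      _ = _ := by rw [map_pow]; ring
  have hc : PowerSeries.coeff (2 * d) (factorProd n (k + 1) (k + 1) n) =
      ∑ p ∈ Finset.HasAntidiagonal.antidiagonal (2 * d), PowerSeries.coeff p.1 (factorProd n k k n) *
        MvPolynomial.X k ^ p.2 := by
    have h := congrArg (PowerSeries.coeff (2 * d)) hE
    rw [PowerSeries.coeff_mul _ (factorProd n k k n)] at h
    simp only [PowerSeries.coeff_mk] at h
    rw [← h, add_mul, one_mul, map_add, mul_assoc, mul_comm PowerSeries.X, PowerSeries.coeff_C_mul]
    cases d with
    | zero => simp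
    | succ d =>
      rw [show 2 * (d + 1) = 2 * d + 1 + 1 by ring, PowerSeries.coeff_succ_mul_X,
        coeff_factorProd_odd (m := 2 * d + 1) ⟨d, rfl⟩, mul_zero, add_zero]
  rw [hc, Finset.mul_sum, map_sum, demazureWord_sum]
  have hterm : ∀ p ∈ Finset.HasAntidiagonal.antidiagonal (2 * d),
      demazureWord (block k) (poly (MvPolynomial.X k ^ (2 * (n - 1 - k.val) + 1) *
        (PowerSeries.coeff p.1 (factorProd n k k n) * MvPolynomial.X k ^ p.2))) =
      poly (PowerSeries.coeff p.1 (factorProd n k k n) * PowerSeries.coeff p.2 V) := by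
    intro p _
    rw [mul_left_comm, ← pow_add, map_mul, demazureWord_mul_left, demazureWord_block_pow k hV hs,
      map_mul]
    intro i hi
    rw [s_poly_eq_sPoly, sPoly_coeff_factorProd (le_of_mem_block hi)]
  rw [Finset.sum_congr rfl hterm, ← map_sum, ← PowerSeries.coeff_mul, mul_comm _ V, hV,
    PowerSeries.coeff_one]
  by_cases hd : d = 0 <;> simp [hd]

theorem demazureWord_block_om {n : ℕ} (k : Fin n) :
    demazureWord (block k) (poly (MvPolynomial.X k ^ (2 * (n - 1 - k.val) + 1)) * om k) =
      theta k := by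
  rw [om_eq_sum, Finset.mul_sum, demazureWord_sum]
  have h : ∀ j ∈ Finset.Ici k, demazureWord (block k)
      (poly (MvPolynomial.X k ^ (2 * (n - 1 - k.val) + 1)) * (poly (omCoeff k j) * theta j)) =
      if j = k then theta k else 0 := by
    intro j hj
    have hkj : k ≤ j := Finset.mem_Ici.mp hj
    have hj' : k.val ≤ j.val := hkj
    rw [← mul_assoc, ← map_mul, demazureWord_mul_right fun i _ => s_theta i j, omCoeff,
      mul_left_comm, map_mul, demazureWord_mul_left, demazureWord_block_pow_mul_coeff]
    · by_cases hjk : j = k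
      · simp [hjk]
      · have : ¬ j.val - k.val = 0 := fun e => hjk (Fin.ext (by omega))
        rw [if_neg this, if_neg hjk, mul_zero, zero_mul]
    · intro i _
      simp
  rw [Finset.sum_congr rfl h]
  simp

theorem demazureWord_block_pow_self {n : ℕ} (k : Fin n) :
    demazureWord (block k) (poly (MvPolynomial.X k ^ (2 * (n - 1 - k.val) + 1))) = 1 := by
  have h := demazureWord_block_pow_mul_coeff k 0
  simpa [constantCoeff_factorProd] using h

/-! ### The whole longest word -/

/-- The odd generators after the blocks `k, k+1, …` have been applied. -/
def partialTheta {n : ℕ} (k : ℕ) (p : Fin n) : PExt n := if k ≤ p.val then theta p else om p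

theorem partialTheta_succ_of_ne {n k : ℕ} {p : Fin n} (h : p.val ≠ k) :
    partialTheta (k + 1) p = partialTheta k p := by
  unfold partialTheta
  split_ifs <;> first | omega | rfl

theorem s_partialTheta {n : ℕ} {i p : Fin n} {k : ℕ} (hi : k ≤ i.val) :
    s i (partialTheta k p) = partialTheta k p := by
  unfold partialTheta
  split_ifs with h
  · exact s_theta i p
  · refine s_om_of_ne (Or.inl fun e => h ?_)
    rwa [← e]

theorem s_list_prod {n : ℕ} {i : Fin n} {k : ℕ} (hi : k ≤ i.val) (l : List (Fin n)) :
    s i (l.map (partialTheta k)).prod = (l.map (partialTheta k)).prod := by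
  rw [map_list_prod, List.map_map]
  congr 1
  exact List.map_congr_left fun p _ => s_partialTheta hi

/-- Every factor except a possible ω_k is fixed by the letters of the block: the θ's always, and ω_p
with p < k because only s_p moves it. Absence of repetitions leaves at most one ω_k. -/
theorem demazureWord_block_list {n : ℕ} (k : Fin n) {l : List (Fin n)} (hl : l.Nodup) :
    demazureWord (block k) (poly (MvPolynomial.X k ^ (2 * (n - 1 - k.val) + 1)) *
      (l.map (partialTheta (k.val + 1))).prod) = (l.map (partialTheta k.val)).prod := by
  have hmap : ∀ l' : List (Fin n), k ∉ l' →
      l'.map (partialTheta (k.val + 1)) = l'.map (partialTheta k.val) := fun l' hk =>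
    List.map_congr_left fun p hp =>
      partialTheta_succ_of_ne fun e => hk ((Fin.ext e : p = k) ▸ hp)
  have hinv : ∀ l' : List (Fin n), ∀ i ∈ block k,
      s i (l'.map (partialTheta k.val)).prod = (l'.map (partialTheta k.val)).prod :=
    fun l' i hi => s_list_prod (le_of_mem_block hi) l'
  by_cases hk : k ∈ l
  · obtain ⟨l₁, l₂, rfl⟩ := List.append_of_mem hk
    have hd := List.nodup_middle.mp hl
    rw [List.nodup_cons, List.mem_append, not_or] at hd
    have e1 : partialTheta (k.val + 1) k = om k := if_neg (by omega)
    have e2 : partialTheta k.val k = theta k := if_pos le_rfl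
    rw [List.map_append, List.map_cons, List.map_append, List.map_cons, hmap _ hd.1.1,
      hmap _ hd.1.2, List.prod_append, List.prod_cons, List.prod_append, List.prod_cons, e1, e2,
      ← mul_assoc, poly_mul_comm, mul_assoc, demazureWord_mul_left (hinv l₁), ← mul_assoc (poly _),
      demazureWord_mul_right (hinv l₂), demazureWord_block_om]
  · rw [hmap l hk, demazureWord_mul_right (hinv l), demazureWord_block_pow_self, one_mul]

/-- The monomial `∏ x_p^{2(n-p)+1}` over the first `k` variables. -/
def partialDelta (n k : ℕ) : MvPolynomial (Fin n) ℚ :=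
  ∏ p : Fin n, if p.val < k then MvPolynomial.X p ^ (2 * (n - 1 - p.val) + 1) else 1

theorem partialDelta_succ {n k : ℕ} (hk : k < n) :
    partialDelta n (k + 1) =
      partialDelta n k * MvPolynomial.X ⟨k, hk⟩ ^ (2 * (n - 1 - k) + 1) := by
  apply prod_eq_mul_of_ne ⟨k, hk⟩
  · simp
  · intro p hp
    have hp' : p.val ≠ k := fun e => hp (Fin.ext e)
    split_ifs <;> first | omega | rfl

theorem sPoly_partialDelta {n k : ℕ} {i : Fin n} (hi : k ≤ i.val) :
    sPoly i (partialDelta n k) = partialDelta n k := by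
  rw [partialDelta, map_prod]
  refine Finset.prod_congr rfl fun p _ => ?_
  split_ifs with h
  · rw [map_pow, sPoly_X]
    congr 1
    have hpi : p ≠ i := fun e => by subst e; omega
    by_cases h1 : i.val + 1 < n
    · rw [sX_swap h1, Equiv.swap_apply_of_ne_of_ne hpi]
      intro e
      have := congrArg Fin.val e
      simp only at this
      omega
    · rw [sX_last h1, if_neg hpi]
  · exact map_one _

theorem demazureWord_flatMap_block {n : ℕ} {l : List (Fin n)} (hl : l.Nodup) (d : ℕ) {k : ℕ}
    (hk : k + d = n) :
    demazureWord ((ascendingFrom n k).flatMap block) (poly (partialDelta n n) * (l.map om).prod) =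
      poly (partialDelta n k) * (l.map (partialTheta k)).prod := by
  induction d generalizing k with
  | zero =>
    obtain rfl : k = n := hk
    have e : l.map (partialTheta k) = l.map om :=
      List.map_congr_left fun p _ => if_neg (not_le.mpr p.2)
    rw [ascendingFrom_self, e]
    rfl
  | succ d ih =>
    have hkn : k < n := by omega
    rw [ascendingFrom_eq_cons hkn, List.flatMap_cons, demazureWord_append, ih (by omega),
      partialDelta_succ hkn, map_mul, mul_assoc, demazureWord_mul_left,
      demazureWord_block_list ⟨k, hkn⟩ hl]
    intro i hi
    have : k ≤ i.val := le_of_mem_block hi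
    rw [s_poly_eq_sPoly, sPoly_partialDelta this]

/-- `S_{0,β}` is the product of the invariant odd generators indexed by the parts of `β`. -/
theorem schur_eq_prod {n k : ℕ} (β : StrictPartition n k) :
    schur 0 β = (List.ofFn fun j => theta (β j)).prod := by
  have hl : (List.ofFn β).Nodup := List.nodup_ofFn.mpr β.injective
  have h := demazureWord_flatMap_block hl n (zero_add n)
  have h1 : longestWord n = (ascendingFrom n 0).flatMap block := by
    simp only [longestWord, ascendingFrom, Nat.zero_le, decide_true, List.filter_true]
    rfl
  have h2 : monomialDelta 0 = poly (partialDelta n n) := by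
    simp [monomialDelta, partialDelta]
  have h3 : partialDelta n 0 = 1 := by simp [partialDelta]
  have h4 : (partialTheta 0 : Fin n → PExt n) = theta := by
    funext p
    exact if_pos (Nat.zero_le _)
  rw [h3, h4, map_one, one_mul, List.map_ofFn, List.map_ofFn] at h
  rw [schur, h1, h2]
  exact h

/-! ### Anticommutation and signs -/

/-- The linear combinations of the `ω_j` with polynomial coefficients. -/
def oddPart (n : ℕ) : AddSubgroup (PExt n) :=
  AddSubgroup.closure {f | ∃ p j, f = poly p * om j}

theorem poly_mul_mem_oddPart {n : ℕ} (p : MvPolynomial (Fin n) ℚ) {f : PExt n}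
    (hf : f ∈ oddPart n) : poly p * f ∈ oddPart n := by
  induction hf using AddSubgroup.closure_induction with
  | mem f hf =>
    obtain ⟨q, j, rfl⟩ := hf
    exact AddSubgroup.subset_closure ⟨p * q, j, by rw [map_mul, mul_assoc]⟩
  | zero => rw [mul_zero]; exact zero_mem _
  | add a b _ _ ha hb => rw [mul_add]; exact add_mem ha hb
  | neg a _ ha => rw [mul_neg]; exact neg_mem ha

theorem oddPart_swap {n : ℕ} {f g : PExt n} (hf : f ∈ oddPart n) (hg : g ∈ oddPart n) :
    f * g = -(g * f) := by
  induction hf, hg using AddSubgroup.closure_induction₂ with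
  | mem f g hf hg =>
    obtain ⟨p, i, rfl⟩ := hf
    obtain ⟨q, j, rfl⟩ := hg
    exact poly_om_swap p q i j
  | zero_left => simp
  | zero_right => simp
  | add_left a b c _ _ _ ha hb => rw [add_mul, mul_add, ha, hb, neg_add]
  | add_right a b c _ _ _ ha hb => rw [add_mul, mul_add, ha, hb, neg_add]
  | neg_left a b _ _ h => rw [neg_mul, h, mul_neg]
  | neg_right a b _ _ h => rw [mul_neg, h, neg_mul]

theorem theta_mem_oddPart {n : ℕ} (k : Fin n) : theta k ∈ oddPart n := by
  obtain ⟨d, hd⟩ : ∃ d, n - k.val = d := ⟨_, rfl⟩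
  induction d using Nat.strong_induction_on generalizing k with
  | _ d ih =>
    rw [← sub_eq_of_eq_add (om_eq_add k)]
    refine sub_mem (AddSubgroup.subset_closure ⟨1, k, by rw [map_one, one_mul]⟩)
      (sum_mem fun j hj => poly_mul_mem_oddPart _ (ih _ ?_ j rfl))
    have hkj : k < j := Finset.mem_Ioi.mp hj
    have : k.val < j.val := hkj
    omega

/-- The algebra homomorphism that maps the generators of the exterior algebra to the `theta j`. -/
theorem exists_lift_theta (n : ℕ) :
    ∃ φ : ExteriorAlgebra ℚ (Fin n → ℚ) →ₐ[ℚ] PExt n,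
      ∀ j, φ (ExteriorAlgebra.ι ℚ (Pi.single j 1)) = theta j := by
  have hmem : ∀ m, Fintype.linearCombination ℚ (theta (n := n)) m ∈ oddPart n := by
    intro m
    rw [Fintype.linearCombination_apply]
    refine sum_mem fun j _ => ?_
    rw [Algebra.smul_def, ← poly.commutes]
    exact poly_mul_mem_oddPart _ (theta_mem_oddPart j)
  have hsq : ∀ m, Fintype.linearCombination ℚ (theta (n := n)) m *
      Fintype.linearCombination ℚ (theta (n := n)) m = 0 := fun m => by
    have h := oddPart_swap (hmem m) (hmem m)
    have h2 : (2 : ℚ) • (Fintype.linearCombination ℚ (theta (n := n)) m *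
        Fintype.linearCombination ℚ (theta (n := n)) m) = 0 := by
      rw [two_smul]
      nth_rewrite 1 [h]
      exact neg_add_cancel _
    exact (smul_eq_zero.mp h2).resolve_left two_ne_zero
  refine ⟨ExteriorAlgebra.lift ℚ ⟨Fintype.linearCombination ℚ theta, hsq⟩, fun j => ?_⟩
  rw [ExteriorAlgebra.lift_ι_apply]
  simp [Fintype.linearCombination_apply_single]

/-- The sign is a product over pairs i < j in which each inversion contributes -1. -/
theorem sign_eq_neg_one_pow_permLength {m : ℕ} (σ : Equiv.Perm (Fin m)) :
    Equiv.Perm.sign σ = (-1) ^ permLength σ := by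
  rw [Equiv.Perm.sign_eq_prod_prod_Ioi, permLength, ← Finset.prod_const, Finset.prod_filter,
    Fintype.prod_prod_type]
  refine Finset.prod_congr rfl fun i _ => ?_
  have hI : Finset.Ioi i = Finset.univ.filter (i < ·) := by ext; simp
  rw [hI, Finset.prod_filter]
  refine Finset.prod_congr rfl fun j _ => ?_
  by_cases hij : i < j
  · rcases lt_or_gt_of_ne (σ.injective.ne hij.ne) with h | h
    · simp [hij, h, h.not_gt]
    · simp [hij, h, h.not_gt]
  · simp [hij]

theorem schur_mul_schur {n k l : ℕ} (β : StrictPartition n k) (β' : StrictPartition n l) :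
    schur 0 β * schur 0 β' = (List.ofFn fun j => theta (concat β β' j)).prod := by
  rw [schur_eq_prod, schur_eq_prod, ← List.prod_append, ← List.ofFn_fin_append]
  congr 2
  funext j
  refine Fin.addCases (fun i => ?_) (fun i => ?_) j <;> simp [concat]

end ExtSchur

end

theorem lemma4 {n k l : ℕ} (β : ExtSchur.StrictPartition n k) (β' : ExtSchur.StrictPartition n l) :
    (∀ h : ExtSchur.NoCommonPart β β',
      ExtSchur.schur 0 β * ExtSchur.schur 0 β' =
        (-1) ^ ExtSchur.eps β β' * ExtSchur.schur 0 (ExtSchur.merge β β' h)) ∧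
    (¬ ExtSchur.NoCommonPart β β' → ExtSchur.schur 0 β * ExtSchur.schur 0 β' = 0) := by
  obtain ⟨φ, hφ⟩ := ExtSchur.exists_lift_theta n
  -- Products of θ's are values of an alternating map, so sorting costs a sign and a repeated index
  -- gives zero.
  have hprod : ∀ {m : ℕ} (c : Fin m → Fin n),
      (List.ofFn fun j => ExtSchur.theta (c j)).prod =
        φ (ExteriorAlgebra.ιMulti ℚ m fun j => Pi.single (c j) 1) := by
    intro m c
    rw [ExteriorAlgebra.ιMulti_apply, map_list_prod, List.map_ofFn]
    congr 2
    funext j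
    exact (hφ _).symm
  rw [ExtSchur.schur_mul_schur, hprod]
  constructor
  · intro h
    have hm : (fun j => Pi.single (ExtSchur.merge β β' h j) 1 : Fin (k + l) → Fin n → ℚ) =
        (fun j => Pi.single (ExtSchur.concat β β' j) 1) ∘ ExtSchur.sortPerm β β' := rfl
    rw [ExtSchur.schur_eq_prod, hprod, hm, AlternatingMap.map_perm,
      ExtSchur.sign_eq_neg_one_pow_permLength, ExtSchur.eps, Units.smul_def]
    -- The sign from sorting meets the sign in the claim, and the two cancel in either parity.
    rcases Nat.even_or_odd (ExtSchur.permLength (ExtSchur.sortPerm β β')) with he | ho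
    · simp [he.neg_one_pow]
    · simp [ho.neg_one_pow]
  · intro h
    rw [AlternatingMap.map_eq_zero_of_not_injective, map_zero]
    intro hinj
    have hc : Function.Injective (ExtSchur.concat β β') := fun a b hab =>
      hinj (by simp only [hab])
    exact h (Fin.append_injective_iff.mp hc).2.2
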